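/- Let $R$ be a real rational function and, for $s\ge 0$, put $$\gamma(s)=\frac{e^{-s}-R(s)}{1-|R(s)|},\qquad \gamma_{\mathrm{lin}}=\sup_{s>0}|\gamma(s)|,$$ where $\gamma(0)=0$ is the continuous extension. Assume that $R(0)=1$, $R'(0)=-1$, $0<R(s)<1$ for all $s>0$, and that $|\gamma|$ attains its maximum over $[0,\infty)$ at exactly one point $s_0$, with $s_0\ne 0$. For $z>0$ and an integer $n\ge 0$ let $F_1^{(n)}(z)$, $F_2^{(n)}(z)$ be the coefficients of the $n$-step BDF2 propagator for the test equation, i.e. $U_n=F_1^{(n)}(z)U_{-1}+F_2^{(n)}(z)U_0$ whenever $(3+2z)U_m=4U_{m-1}-U_{m-2}$ for $m\ge 1$. For an integer $J\ge 2$ put $G_1=R(Jz)$ and either $G_2=R(Jz)$ (coarse propagators of type (I)) or $G_2=R((J-1)z)$ (type (II)), and $$\eta_1=F_1^{(J-1)}-F_1^{(J)}\tfrac{G_2}{G_1},\quad \eta_2=F_1^{(J-1)}+F_2^{(J-1)}\tfrac{G_1}{G_2}-F_1^{(J)}\tfrac{G_2}{G_1}-F_2^{(J)},\quad \eta_3=F_1^{(J)}\tfrac{G_2}{G_1},\quad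 \eta_4=F_1^{(J)}\tfrac{G_2}{G_1}+F_2^{(J)}-G_1,$$ all evaluated at $z$. Further let $$\gamma_a=\sum_{m=0}^\infty|G_1|^m\,\bigl|(m+1)\eta_4^2+\eta_2\eta_3\bigr|,\qquad \gamma_b=\frac{|\eta_2\eta_3|}{1-|G_1|}\Bigl(|\eta_1|+\frac{|\eta_4|}{1-|G_1|}\Bigr)^2,$$ $$\gamma_c=\frac{|\eta_2\eta_3^2\eta_4|}{(1-|G_1|)^3}+\frac{|\eta_1\eta_2\eta_3^2|}{(1-|G_1|)^2}+\frac{|\eta_1^2\eta_3\eta_4|}{(1-|G_1|)^2}+\frac{|\eta_1^3\eta_3|}{1-|G_1|},$$ $$\gamma_d=\frac{|G_1\eta_2\eta_4|}{1-|G_1|}+|\eta_2(\eta_4+\eta_1)|,\qquad \gamma_e=\frac{|G_1\eta_2\eta_3|}{1-|G_1|}+|\eta_2\eta_3+\eta_1^2|.$$ Let $\xi_1(z,J),\xi_2(z,J),\xi_3(z,J)\in\mathbb C$ be the roots of $$\xi^3-(\gamma_a+\gamma_e)\xi^2+(\gamma_a\gamma_e-\gamma_b)\xi+(\gamma_b\gamma_e-\gamma_c\gamma_d)=0,$$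 and let $\gamma^\dagger(J)=\sup_{z>0}\max_{\ell}|\xi_\ell(z,J)|$ be the convergence factor of the multistep parareal method with BDF2 as fine propagator. Then, for either type of coarse propagators, there is a constant $C$, independent of $J$ (and $z$), such that for all $J\ge 2$ the supremum $\gamma^\dagger(J)$ is finite and $$\bigl|\gamma^\dagger(J)-\gamma_{\mathrm{lin}}^2\bigr|\le \frac{C}{J}.$$ In particular $\gamma^\dagger(J)\to\gamma_{\mathrm{lin}}^2$ as $J\to\infty$. -/

import Mathlib

namespace MultistepParareal

open Set

noncomputable section

/-- The value `R(s)` of a real rational function at a real point (reduced numerator over reduced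
denominator). -/
def stab (R : RatFunc ℝ) (s : ℝ) : ℝ := R.eval (RingHom.id ℝ) s

/-- The convergence function `γ(s) = (e^{-s} - R(s)) / (1 - |R(s)|)` of plain parareal with an exact
fine propagator. If `R(0) = 1` and `R'(0) = -1`, its continuous extension to `s = 0` has the value `0`,
which is also the value of this expression at `s = 0` (as `0 / 0 = 0`). -/
def plainConvFun (R : RatFunc ℝ) (s : ℝ) : ℝ :=
  (Real.exp (-s) - stab R s) / (1 - |stab R s|)

/-- The plain parareal convergence factor `γ_lin = sup_{s > 0} |γ(s)|`. -/
def plainConvFactor (R : RatFunc ℝ) : ℝ :=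
  sSup ((fun s => |plainConvFun R s|) '' Ioi 0)

/-- The assumptions on the stability function of the coarse propagator. -/
structure StabilityAssumption (R : RatFunc ℝ) : Prop where
  value_zero : stab R 0 = 1
  deriv_zero : HasDerivAt (stab R) (-1) 0
  mem_Ioo : ∀ s : ℝ, 0 < s → stab R s ∈ Ioo (0 : ℝ) 1
  /-- On `[0, ∞)`, `|γ|` attains its maximum at exactly one point `s₀`, and `s₀ ≠ 0`. -/
  unique_max : ∃ s₀ : ℝ, 0 ≤ s₀ ∧ s₀ ≠ 0 ∧
    ∀ s : ℝ, 0 ≤ s → s ≠ s₀ → |plainConvFun R s| < |plainConvFun R s₀|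

/-- The BDF2 solution of `u' + λ u = 0` with step `τ`, `z = τ λ`, and starting values `U_{-1} = u`,
`U_0 = v`; that is, `(3/2) U_n - 2 U_{n-1} + (1/2) U_{n-2} + z U_n = 0` for `n ≥ 1`. -/
def bdf2 (z u v : ℝ) : ℕ → ℝ
  | 0 => v
  | 1 => (4 * v - u) / (3 + 2 * z)
  | n + 2 => (4 * bdf2 z u v (n + 1) - bdf2 z u v n) / (3 + 2 * z)

/-- `F₁^{(n)}(z)`: the coefficient of `U_{-1}` in the BDF2 solution after `n` steps. -/
def F₁ (n : ℕ) (z : ℝ) : ℝ := bdf2 z 1 0 n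

/-- `F₂^{(n)}(z)`: the coefficient of `U_0` in the BDF2 solution after `n` steps. -/
def F₂ (n : ℕ) (z : ℝ) : ℝ := bdf2 z 0 1 n

/-- The two choices of coarse propagators. -/
inductive CPType
  | I
  | II

/-- `R_i(s) = R(s)` for type (I) and `R_i(s) = R(((J - (i - 1)) / J) s)` for type (II). -/
def stage (T : CPType) (R : RatFunc ℝ) (J i : ℕ) (s : ℝ) : ℝ :=
  match T with
  | .I => stab R s
  | .II => stab R (((J : ℝ) - ((i : ℝ) - 1)) / J * s)

def G₁ (T : CPType) (R : RatFunc ℝ) (J : ℕ) (z : ℝ) : ℝ := stage T R J 1 (J * z)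

def G₂ (T : CPType) (R : RatFunc ℝ) (J : ℕ) (z : ℝ) : ℝ := stage T R J 2 (J * z)

def η₁ (T : CPType) (R : RatFunc ℝ) (J : ℕ) (z : ℝ) : ℝ :=
  F₁ (J - 1) z - F₁ J z * (G₂ T R J z / G₁ T R J z)

def η₂ (T : CPType) (R : RatFunc ℝ) (J : ℕ) (z : ℝ) : ℝ :=
  F₁ (J - 1) z + F₂ (J - 1) z * (G₁ T R J z / G₂ T R J z)
    - F₁ J z * (G₂ T R J z / G₁ T R J z) - F₂ J z

def η₃ (T : CPType) (R : RatFunc ℝ) (J : ℕ) (z : ℝ) : ℝ :=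
  F₁ J z * (G₂ T R J z / G₁ T R J z)

def η₄ (T : CPType) (R : RatFunc ℝ) (J : ℕ) (z : ℝ) : ℝ :=
  F₁ J z * (G₂ T R J z / G₁ T R J z) + F₂ J z - G₁ T R J z

def γa (T : CPType) (R : RatFunc ℝ) (J : ℕ) (z : ℝ) : ℝ :=
  ∑' m : ℕ, |G₁ T R J z| ^ m * |((m : ℝ) + 1) * η₄ T R J z ^ 2 + η₂ T R J z * η₃ T R J z|

def γb (T : CPType) (R : RatFunc ℝ) (J : ℕ) (z : ℝ) : ℝ :=
  |η₂ T R J z * η₃ T R J z| / (1 - |G₁ T R J z|)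
    * (|η₁ T R J z| + |η₄ T R J z| / (1 - |G₁ T R J z|)) ^ 2

def γc (T : CPType) (R : RatFunc ℝ) (J : ℕ) (z : ℝ) : ℝ :=
  |η₂ T R J z * η₃ T R J z ^ 2 * η₄ T R J z| / (1 - |G₁ T R J z|) ^ 3
    + |η₁ T R J z * η₂ T R J z * η₃ T R J z ^ 2| / (1 - |G₁ T R J z|) ^ 2
    + |η₁ T R J z ^ 2 * η₃ T R J z * η₄ T R J z| / (1 - |G₁ T R J z|) ^ 2
    + |η₁ T R J z ^ 3 * η₃ T R J z| / (1 - |G₁ T R J z|)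

def γd (T : CPType) (R : RatFunc ℝ) (J : ℕ) (z : ℝ) : ℝ :=
  |G₁ T R J z * η₂ T R J z * η₄ T R J z| / (1 - |G₁ T R J z|)
    + |η₂ T R J z * (η₄ T R J z + η₁ T R J z)|

def γe (T : CPType) (R : RatFunc ℝ) (J : ℕ) (z : ℝ) : ℝ :=
  |G₁ T R J z * η₂ T R J z * η₃ T R J z| / (1 - |G₁ T R J z|)
    + |η₂ T R J z * η₃ T R J z + η₁ T R J z ^ 2|

/-- The complex roots `ξ_ℓ(z, J)` of the cubic equation, i.e. the eigenvalues of the matrix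
`!![γa, γb, γc; 1, 0, 0; 0, γd, γe]` of the error recursion. -/
def cubicRoots (T : CPType) (R : RatFunc ℝ) (J : ℕ) (z : ℝ) : Set ℂ :=
  {ξ : ℂ | ξ ^ 3 - ((γa T R J z + γe T R J z : ℝ) : ℂ) * ξ ^ 2
    + ((γa T R J z * γe T R J z - γb T R J z : ℝ) : ℂ) * ξ
    + ((γb T R J z * γe T R J z - γc T R J z * γd T R J z : ℝ) : ℂ) = 0}

/-- The multistep convergence function `γ(z, J) = max_ℓ |ξ_ℓ(z, J)|` (a supremum over a finite
non-empty set). -/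
def multistepConvFun (T : CPType) (R : RatFunc ℝ) (J : ℕ) (z : ℝ) : ℝ :=
  sSup ((fun ξ : ℂ => ‖ξ‖) '' cubicRoots T R J z)

/-- The multistep convergence factor `γ†(J) = sup_{z > 0} γ(z, J)`. -/
def multistepConvFactor (T : CPType) (R : RatFunc ℝ) (J : ℕ) : ℝ :=
  sSup (multistepConvFun T R J '' Ioi 0)

end

end MultistepParareal

/-! Put `s = J z`, `q = z / (1 + J z)`. Uniformly in `z`, the cubic is an `O(1/J)` perturbation of
`(ξ - γ(s)²) ξ² = 0`.

Two facts about BDF2 are used: differences of solutions with bounded starting values are `O(1/J)`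
after `J` steps (`bdf2_diff`), and `F₁ + F₂`, the solution starting from `1, 1`, equals `e^{-s} +
O(q)` (`bdf2_error`). As `R` is rational, `log R` has derivative `O(1/(1+s))`, so `G₂/G₁ = 1 + O(q)`
(`exists_ratio_bound`). The link is `J q = s/(1+s) ≤ 1 - e^{-s} ≤ (1 + γ_lin)(1 - G₁)`: errors
`O(q)` survive division by `1 - G₁`, which degenerates as `s → 0`. This gives `exists_eta_bounds`,
and then `γa = γ(s)² + O(1/J)`, while `γb`, `γe` and `γc γd` are `O(1/J)` (`exists_gamma_bounds`).

The cubic reads `(ξ - γa) ξ (ξ - γe) = γb (ξ - γe) + γc γd`. A root far beyond `γ_lin²` makes the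
left side too large (`cubic_root_norm_le`; `γ_lin > 0` keeps the bound linear in `1/J`), and some
real root is at least `γa` (`exists_cubic_root_ge`), which at `z = s₀/J` gives the lower bound. -/

namespace MultistepParareal

/-! ### BDF2: decay, differences and error, uniformly in `z` -/

section Decay

variable {z : ℝ} {x : ℕ → ℝ}

/-- One step of the BDF2 recursion contracts `|v| + |d| / 2`, where `d` is the backward difference
and `v` is the current value plus `d / 2`. -/
lemma bdf2_norm_step (hz : 0 < z) (hz3 : z ≤ 3)
    (hx : ∀ n, (3 + 2 * z) * x (n + 2) = 4 * x (n + 1) - x n) (n : ℕ) :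
    (1 + z / 11) * (|x (n + 2) + (x (n + 2) - x (n + 1)) / 2| + |x (n + 2) - x (n + 1)| / 2) ≤
      |x (n + 1) + (x (n + 1) - x n) / 2| + |x (n + 1) - x n| / 2 := by
  set d := x (n + 1) - x n with hd
  set v := x (n + 1) + d / 2 with hv
  set d' := x (n + 2) - x (n + 1) with hd'
  set v' := x (n + 2) + d' / 2 with hv'
  have hp : 0 < 3 + 2 * z := by linarith
  have h0 := hx n
  have e1 : (3 + 2 * z) * v' = (3 - z) * v + (z / 2) * d := by
    rw [hv', hd', hv, hd]; linear_combination (3 / 2) * h0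
  have e2 : (3 + 2 * z) * d' = (1 + z) * d - 2 * z * v := by
    rw [hd', hv, hd]; linear_combination h0
  have b1 : (3 + 2 * z) * |v'| ≤ (3 - z) * |v| + (z / 2) * |d| := by
    rw [← abs_of_pos hp, ← abs_mul, e1]
    refine (abs_add_le _ _).trans ?_
    rw [abs_mul, abs_mul, abs_of_nonneg (by linarith : 0 ≤ 3 - z),
      abs_of_nonneg (by linarith : 0 ≤ z / 2)]
  have b2 : (3 + 2 * z) * |d'| ≤ (1 + z) * |d| + 2 * z * |v| := by
    rw [← abs_of_pos hp, ← abs_mul, e2]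
    refine (abs_sub _ _).trans ?_
    rw [abs_mul, abs_mul, abs_of_nonneg (by linarith : 0 ≤ 1 + z),
      abs_of_nonneg (by linarith : 0 ≤ 2 * z)]
  have b3 : (3 + 2 * z) * (|v'| + |d'| / 2) ≤ 3 * |v| + (1 + 2 * z) * (|d| / 2) := by
    linarith
  have hV := abs_nonneg v
  have hD := abs_nonneg d
  have c1 : (1 + z / 11) * 3 ≤ 3 + 2 * z := by linarith
  -- This amounts to `z + 2 z² ≤ 22`; at `z = 3` the left side is 21, whence the 11.
  have c2 : (1 + z / 11) * (1 + 2 * z) ≤ 3 + 2 * z := by nlinarith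
  have b4 : (3 + 2 * z) * ((1 + z / 11) * (|v'| + |d'| / 2)) ≤
      (3 + 2 * z) * (|v| + |d| / 2) := by
    calc _ = (1 + z / 11) * ((3 + 2 * z) * (|v'| + |d'| / 2)) := by ring
      _ ≤ (1 + z / 11) * (3 * |v| + (1 + 2 * z) * (|d| / 2)) := by gcongr
      _ = ((1 + z / 11) * 3) * |v| + ((1 + z / 11) * (1 + 2 * z)) * (|d| / 2) := by ring
      _ ≤ (3 + 2 * z) * |v| + (3 + 2 * z) * (|d| / 2) := by gcongr
      _ = _ := by ring
  exact le_of_mul_le_mul_left b4 hp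

/-- The contracted norm starts at most at 3 and dominates `|x (n + 1)|`; Bernoulli's inequality
turns the geometric rate into `1 + n z / 11`, and `33 = 3 * 11`. -/
lemma bdf2_decay_of_le (hz : 0 < z) (hz3 : z ≤ 3)
    (hx : ∀ n, (3 + 2 * z) * x (n + 2) = 4 * x (n + 1) - x n)
    (h0 : |x 0| ≤ 1) (h1 : |x 1| ≤ 1) (n : ℕ) : |x (n + 1)| ≤ 33 / (1 + n * z) := by
  have key : ∀ n : ℕ, (1 + z / 11) ^ n *
      (|x (n + 1) + (x (n + 1) - x n) / 2| + |x (n + 1) - x n| / 2) ≤ 3 := by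
    intro n
    induction n with
    | zero =>
      have := abs_le.1 h0
      have := abs_le.1 h1
      have a1 : |x 1 - x 0| ≤ 2 := abs_le.2 ⟨by linarith, by linarith⟩
      have a2 : |x 1 + (x 1 - x 0) / 2| ≤ 2 := abs_le.2 ⟨by linarith, by linarith⟩
      simp only [pow_zero, zero_add, one_mul]
      linarith
    | succ n ih =>
      have h := bdf2_norm_step hz hz3 hx n
      refine le_trans ?_ ih
      rw [pow_succ, mul_assoc]
      exact mul_le_mul_of_nonneg_left h (by positivity)
  have hb : 1 + n * (z / 11) ≤ (1 + z / 11) ^ n :=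
    one_add_mul_le_pow (by linarith) n
  have hw : |x (n + 1)| ≤
      |x (n + 1) + (x (n + 1) - x n) / 2| + |x (n + 1) - x n| / 2 := by
    have h := abs_sub (x (n + 1) + (x (n + 1) - x n) / 2) ((x (n + 1) - x n) / 2)
    rw [add_sub_cancel_right, abs_div, abs_two] at h
    exact h
  have hn : (0 : ℝ) ≤ n := n.cast_nonneg
  have hnz : 0 ≤ (n : ℝ) * z := by positivity
  have h3 : (1 + n * (z / 11)) * |x (n + 1)| ≤ 3 :=
    (mul_le_mul hb hw (abs_nonneg _) (by positivity)).trans (key n)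
  rw [le_div_iff₀ (by positivity)]
  nlinarith [abs_nonneg (x (n + 1))]

/-- For large `z` the factor `3 + 2 z ≥ 9` beats the crude triangle inequality on the recursion. -/
lemma bdf2_decay_of_ge (hz3 : 3 ≤ z)
    (hx : ∀ n, (3 + 2 * z) * x (n + 2) = 4 * x (n + 1) - x n)
    (h0 : |x 0| ≤ 1) (h1 : |x 1| ≤ 1) : ∀ n : ℕ, |x (n + 1)| ≤ 5 / (1 + n * z) := by
  have hp : 0 < 3 + 2 * z := by linarith
  have step : ∀ n, (3 + 2 * z) * |x (n + 2)| ≤ 4 * |x (n + 1)| + |x n| := by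
    intro n
    rw [← abs_of_pos hp, ← abs_mul, hx n]
    refine (abs_sub _ _).trans ?_
    rw [abs_mul, abs_of_pos (by norm_num : (0 : ℝ) < 4)]
  have two : ∀ n : ℕ, |x (n + 1)| ≤ 5 / (1 + n * z) ∧
      |x (n + 2)| ≤ 5 / (1 + ((n + 1 : ℕ) : ℝ) * z) := by
    intro n
    induction n with
    | zero =>
      refine ⟨by simp; linarith, ?_⟩
      rw [le_div_iff₀ (by push_cast; positivity)]
      have := step 0
      simp only [zero_add] at this
      push_cast
      nlinarith [abs_nonneg (x 2)]
    | succ n ih =>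
      refine ⟨ih.2, ?_⟩
      have hs := step (n + 1)
      obtain ⟨i1, i2⟩ := ih
      rw [le_div_iff₀ (by positivity)] at i1 i2 ⊢
      push_cast at *
      have hn : (0 : ℝ) ≤ n := n.cast_nonneg
      have hnz : 0 ≤ (n : ℝ) * z := by positivity
      -- The ratio of `1 + (n + 2) z` to `1 + n z` is at most 3 for `n ≥ 1` but unbounded in `z` for
      -- `n = 0`.
      rcases Nat.eq_zero_or_pos n with rfl | hpos
      · simp only [Nat.cast_zero, zero_mul, add_zero, zero_add, one_mul, mul_one] at *
        have := abs_nonneg (x 3)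
        have hs0 := step 0
        simp only [zero_add] at hs0
        have : |x 2| ≤ 5 / 9 := by nlinarith [abs_nonneg (x 2)]
        nlinarith
      · have hn1 : (1 : ℝ) ≤ n := by exact_mod_cast hpos
        have h2 : |x (n + 2)| * (1 + (n + 1 + 1) * z) ≤ 15 / 2 := by
          nlinarith [abs_nonneg (x (n + 2))]
        have h3 : |x (n + 1)| * (1 + (n + 1 + 1) * z) ≤ 15 := by
          nlinarith [abs_nonneg (x (n + 1))]
        have h4 : (3 + 2 * z) * (|x (n + 1 + 2)| * (1 + (n + 1 + 1) * z)) ≤ 45 := by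
          have : 0 ≤ 1 + ((n : ℝ) + 1 + 1) * z := by positivity
          have := mul_le_mul_of_nonneg_right hs this
          rw [show n + 1 + 1 = n + 2 from rfl] at this
          linarith
        have h5 : 0 ≤ |x (n + 1 + 2)| * (1 + ((n : ℝ) + 1 + 1) * z) := by positivity
        nlinarith
  exact fun n => (two n).1

lemma bdf2_decay (hz : 0 < z)
    (hx : ∀ n, (3 + 2 * z) * x (n + 2) = 4 * x (n + 1) - x n)
    (h0 : |x 0| ≤ 1) (h1 : |x 1| ≤ 1) (n : ℕ) : |x (n + 1)| ≤ 33 / (1 + n * z) := by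
  rcases le_total z 3 with h | h
  · exact bdf2_decay_of_le hz h hx h0 h1 n
  · refine (bdf2_decay_of_ge h hx h0 h1 n).trans ?_
    gcongr
    norm_num

/-- Differences shrink by the parasitic factor 1/3, with forcing `z x` that the decay bound
controls. -/
lemma bdf2_diff_step (hx : ∀ n, (3 + 2 * z) * x (n + 2) = 4 * x (n + 1) - x n) (hz : 0 < z)
    (n : ℕ) : 3 * |x (n + 2) - x (n + 1)| ≤ |x (n + 1) - x n| + 2 * (z * |x (n + 2)|) := by
  have e : 3 * (x (n + 2) - x (n + 1)) = (x (n + 1) - x n) - 2 * (z * x (n + 2)) := by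
    linear_combination hx n
  have h := abs_sub (x (n + 1) - x n) (2 * (z * x (n + 2)))
  rw [← e, abs_mul, abs_mul 2, abs_mul z, abs_of_pos hz, abs_two,
    abs_of_pos (by norm_num : (0 : ℝ) < 3)] at h
  exact h

/-- The differences of a BDF2 solution are `O(1 / n)`, uniformly in `z`. -/
lemma bdf2_diff (hz : 0 < z)
    (hx : ∀ n, (3 + 2 * z) * x (n + 2) = 4 * x (n + 1) - x n)
    (h0 : |x 0| ≤ 1) (h1 : |x 1| ≤ 1) (n : ℕ) : |x (n + 1) - x n| ≤ 132 / (n + 1) := by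
  induction n with
  | zero =>
    have := abs_le.1 h0
    have := abs_le.1 h1
    have a1 : |x 1 - x 0| ≤ 2 := abs_le.2 ⟨by linarith, by linarith⟩
    simp only [zero_add, CharP.cast_eq_zero, div_one]
    linarith
  | succ n ih =>
    have hd := bdf2_decay hz hx h0 h1 (n + 1)
    have hs := bdf2_diff_step hx hz n
    have hn : (0 : ℝ) ≤ n := n.cast_nonneg
    rw [le_div_iff₀ (by positivity)] at ih hd ⊢
    push_cast at *
    have hy : z * |x (n + 2)| * (n + 1) ≤ 33 := by
      nlinarith [abs_nonneg (x (n + 2))]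
    rw [show n + 1 + 1 = n + 2 from rfl]
    nlinarith [abs_nonneg (x (n + 2) - x (n + 1))]

/-- If both starting values are `1`, the differences of a BDF2 solution are `O(z / (1 + n z))`. -/
lemma bdf2_diff_of_one (hz : 0 < z)
    (hx : ∀ n, (3 + 2 * z) * x (n + 2) = 4 * x (n + 1) - x n)
    (h0 : x 0 = 1) (h1 : x 1 = 1) (n : ℕ) : |x (n + 1) - x n| ≤ 132 * z / (1 + n * z) := by
  induction n with
  | zero => simp [h0, h1]; positivity
  | succ n ih =>
    have hd := bdf2_decay hz hx (by simp [h0]) (by simp [h1]) (n + 1)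
    have hs := bdf2_diff_step hx hz n
    rw [le_div_iff₀ (by positivity)] at ih hd ⊢
    push_cast at *
    rw [show n + 1 + 1 = n + 2 from rfl] at *
    have hy : z * |x (n + 2)| * (1 + (n + 1) * z) ≤ 33 * z := by nlinarith
    have hd2 : |x (n + 1) - x n| * (1 + (n + 1) * z) ≤ 264 * z := by
      rcases Nat.eq_zero_or_pos n with rfl | hpos
      · simp [h0, h1]; positivity
      · have hn1 : (1 : ℝ) ≤ n := by exact_mod_cast hpos
        have : 1 + ((n : ℝ) + 1) * z ≤ 2 * (1 + n * z) := by nlinarith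
        nlinarith [abs_nonneg (x (n + 1) - x n)]
    have : 0 ≤ 1 + ((n : ℝ) + 1) * z := by positivity
    have := mul_le_mul_of_nonneg_right hs this
    nlinarith

/-- The consistency defect of backward Euler: quadratic for small `z`, bounded for large `z`. -/
lemma one_sub_one_add_mul_exp_neg_le (hz : 0 < z) :
    1 - (1 + z) * Real.exp (-z) ≤ 3 * z ^ 2 / (2 + z) := by
  rw [le_div_iff₀ (by positivity)]
  have h1 := Real.add_one_le_exp (-z)
  have h2 := Real.exp_pos (-z)
  rcases le_total z 1 with h | h
  · have : 1 - (1 + z) * Real.exp (-z) ≤ z ^ 2 := by nlinarith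
    nlinarith
  · have : 1 - (1 + z) * Real.exp (-z) ≤ 1 := by nlinarith
    nlinarith

lemma exp_neg_le_one_div {t : ℝ} (ht : 0 ≤ t) : Real.exp (-t) ≤ 1 / (1 + t) := by
  rw [Real.exp_neg, ← one_div]
  exact one_div_le_one_div_of_le (by linarith) (by linarith [Real.add_one_le_exp t])

lemma exp_residual_bound (hz : 0 < z) (n : ℕ) :
    (1 - (1 + z) * Real.exp (-z)) * Real.exp (-(n * z)) ≤ 3 * z ^ 2 / (2 + (n + 1) * z) := by
  have hnz : 0 ≤ (n : ℝ) * z := by positivity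
  calc (1 - (1 + z) * Real.exp (-z)) * Real.exp (-(n * z))
      ≤ (3 * z ^ 2 / (2 + z)) * (1 / (1 + n * z)) :=
        mul_le_mul (one_sub_one_add_mul_exp_neg_le hz) (exp_neg_le_one_div hnz)
          (Real.exp_pos _).le (by positivity)
    _ = 3 * z ^ 2 / ((2 + z) * (1 + n * z)) := by rw [div_mul_div_comm, mul_one]
    _ ≤ _ := by
      apply div_le_div_of_nonneg_left (by positivity) (by positivity)
      nlinarith

lemma exp_residual_nonneg (hz : 0 < z) : 0 ≤ 1 - (1 + z) * Real.exp (-z) := by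
  have h := Real.add_one_le_exp z
  have h2 : Real.exp z * Real.exp (-z) = 1 := by rw [← Real.exp_add]; simp
  nlinarith [Real.exp_pos (-z)]

/-- The shifted BDF2 solution with starting values `1`, `1` approximates `e^{-nz}`. -/
lemma bdf2_shifted_error (hz : 0 < z)
    (hx : ∀ n, (3 + 2 * z) * x (n + 2) = 4 * x (n + 1) - x n)
    (h0 : x 0 = 1) (h1 : x 1 = 1) (n : ℕ) :
    |x (n + 1) + (x (n + 1) - x n) / 2 - Real.exp (-(n * z))| ≤ 270 * z / (2 + n * z) := by
  induction n with
  | zero => simp [h0, h1]; positivity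
  | succ n ih =>
    have hd := bdf2_diff_of_one hz hx h0 h1 (n + 1)
    push_cast at *
    rw [show n + 1 + 1 = n + 2 from rfl] at *
    have hnz : 0 ≤ (n : ℝ) * z := by positivity
    have hr := exp_residual_bound hz n
    have hr0 := mul_nonneg (exp_residual_nonneg hz) (Real.exp_pos (-(n * z))).le
    have hE : Real.exp (-((n + 1) * z)) = Real.exp (-z) * Real.exp (-(n * z)) := by
      rw [← Real.exp_add]; congr 1; ring
    set E := Real.exp (-(n * z))
    set ε := x (n + 1) + (x (n + 1) - x n) / 2 - E with hε
    -- The shifted values satisfy backward Euler up to the perturbation `z / 2` times a difference.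
    have e : (1 + z) * (x (n + 2) + (x (n + 2) - x (n + 1)) / 2 - Real.exp (-((n + 1) * z))) =
        ε + z / 2 * (x (n + 2) - x (n + 1)) + (1 - (1 + z) * Real.exp (-z)) * E := by
      rw [hE, hε]; linear_combination (1 / 2) * hx n
    set ε' := x (n + 2) + (x (n + 2) - x (n + 1)) / 2 - Real.exp (-((n + 1) * z))
    have b : (1 + z) * |ε'| ≤ 270 * z / (2 + n * z) + z / 2 * (132 * z / (1 + (n + 1) * z)) +
        3 * z ^ 2 / (2 + (n + 1) * z) := by
      rw [← abs_of_pos (by linarith : 0 < 1 + z), ← abs_mul, e]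
      refine (abs_add_le _ _).trans (add_le_add ((abs_add_le _ _).trans
        (add_le_add ih ?_)) ?_)
      · rw [abs_mul, abs_of_pos (by linarith : 0 < z / 2)]
        gcongr
      · rw [abs_of_nonneg hr0]; exact hr
    have c1 : z / 2 * (132 * z / (1 + (n + 1) * z)) ≤ 132 * z ^ 2 / (2 + (n + 1) * z) := by
      rw [← mul_div_assoc, div_le_div_iff₀ (by positivity) (by positivity)]
      have : 0 ≤ z ^ 2 * (((n : ℝ) + 1) * z) := by positivity
      nlinarith
    -- Since `z / (2 + n z) ≤ z / 2`, half of the damping `z` pays for the growing denominator; the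
    -- other half absorbs the forcing, so `270 = 2 * 135`.
    have c2 : 270 * z / (2 + n * z) + 135 * z ^ 2 / (2 + (n + 1) * z) ≤
        (1 + z) * (270 * z / (2 + (n + 1) * z)) := by
      rw [← mul_div_assoc, div_add_div _ _ (by positivity) (by positivity),
        div_le_div_iff₀ (by positivity) (by positivity)]
      have : 0 ≤ z ^ 2 * ((n : ℝ) * z) * (2 + (n + 1) * z) := by positivity
      nlinarith
    have c3 : 135 * z ^ 2 / (2 + (n + 1) * z) =
        132 * z ^ 2 / (2 + (n + 1) * z) + 3 * z ^ 2 / (2 + (n + 1) * z) := by ring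
    exact le_of_mul_le_mul_left (by linarith) (by linarith : 0 < 1 + z)

lemma bdf2_error (hz : 0 < z)
    (hx : ∀ n, (3 + 2 * z) * x (n + 2) = 4 * x (n + 1) - x n)
    (h0 : x 0 = 1) (h1 : x 1 = 1) (n : ℕ) :
    |x (n + 1) - Real.exp (-(n * z))| ≤ 336 * z / (1 + n * z) := by
  have h2 := bdf2_shifted_error hz hx h0 h1 n
  have h3 := bdf2_diff_of_one hz hx h0 h1 n
  have h4 : 270 * z / (2 + n * z) ≤ 270 * z / (1 + n * z) := by gcongr; norm_num
  have h5 : 336 * z / (1 + n * z) = 270 * z / (1 + n * z) + (132 * z / (1 + n * z)) / 2 := by ring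
  have h6 := abs_sub (x (n + 1) + (x (n + 1) - x n) / 2 - Real.exp (-(n * z)))
    ((x (n + 1) - x n) / 2)
  rw [abs_div, abs_two] at h6
  calc _ = _ := by congr 1; ring
    _ ≤ _ := h6
    _ ≤ _ := by linarith

end Decay

/-! ### Coarse propagators: logarithmic variation of `R` -/

open Polynomial in
/-- The logarithmic derivative of a real polynomial without roots in `[0, ∞)` is
`O(1 / (1 + s))` there. -/
lemma exists_logDeriv_bound (p : ℝ[X]) (hp : ∀ s : ℝ, 0 ≤ s → p.eval s ≠ 0) :
    ∃ K : ℝ, 0 ≤ K ∧ ∀ s : ℝ, 0 ≤ s → |p.derivative.eval s / p.eval s| ≤ K / (1 + s) := by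
  have hp0 : p ≠ 0 := by
    rintro rfl
    exact hp 0 le_rfl (by simp)
  have hdeg : ((X + C 1) * p.derivative).degree ≤ p.degree := by
    rw [degree_eq_natDegree hp0]
    apply degree_le_of_natDegree_le
    rcases Nat.eq_zero_or_pos p.natDegree with h | h
    · rw [eq_C_of_natDegree_eq_zero h]; simp
    · have h1 := natDegree_derivative_le p
      have h2 := natDegree_mul_le (p := (X + C (1 : ℝ))) (q := p.derivative)
      rw [natDegree_X_add_C] at h2
      omega
  obtain ⟨c, hc⟩ := (isBigO_atTop_of_degree_le _ _ hdeg).bound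
  obtain ⟨M, hM⟩ := Filter.eventually_atTop.1 hc
  have hcont : ContinuousOn (fun s => |((X + C 1) * p.derivative).eval s / p.eval s|)
      (Set.Icc 0 M) := by
    refine (ContinuousOn.div (Polynomial.continuousOn _) (Polynomial.continuousOn _) ?_).abs
    exact fun s hs => hp s hs.1
  obtain ⟨B, hB⟩ := isCompact_Icc.bddAbove_image hcont
  refine ⟨max (max c B) 0, le_max_right _ _, fun s hs => ?_⟩
  have key : |((X + C 1) * p.derivative).eval s / p.eval s| ≤ max (max c B) 0 := by
    rcases le_total s M with h | h
    · exact (hB ⟨s, ⟨hs, h⟩, rfl⟩).trans ((le_max_right _ _).trans (le_max_left _ _))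
    · have := hM s h
      rw [Real.norm_eq_abs, Real.norm_eq_abs] at this
      rw [abs_div, div_le_iff₀ (abs_pos.2 (hp s hs))]
      refine this.trans ?_
      gcongr
      exact (le_max_left _ _).trans (le_max_left _ _)
  have e : ((X + C 1) * p.derivative).eval s / p.eval s =
      (1 + s) * (p.derivative.eval s / p.eval s) := by
    simp only [eval_mul, eval_add, eval_X, eval_C]
    ring
  rw [e, abs_mul, abs_of_pos (by linarith : 0 < 1 + s)] at key
  rwa [le_div_iff₀ (by linarith), mul_comm]

open Polynomial in
lemma exists_log_eval_sub_bound (p : ℝ[X]) (hp : ∀ s : ℝ, 0 ≤ s → p.eval s ≠ 0) :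
    ∃ K : ℝ, 0 ≤ K ∧ ∀ s t : ℝ, 0 ≤ t → t ≤ s →
      |Real.log (p.eval s) - Real.log (p.eval t)| ≤ K / (1 + t) * (s - t) := by
  obtain ⟨K, hK, h⟩ := exists_logDeriv_bound p hp
  refine ⟨K, hK, fun s t ht hts => ?_⟩
  have := (convex_Icc t s).norm_image_sub_le_of_norm_hasDerivWithin_le
    (f := fun y => Real.log (p.eval y)) (f' := fun y => p.derivative.eval y / p.eval y)
    (C := K / (1 + t))
    (fun y hy => ((p.hasDerivAt y).log (hp y (ht.trans hy.1))).hasDerivWithinAt)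
    (fun y hy => (h y (ht.trans hy.1)).trans (by gcongr; exact hy.1))
    (Set.left_mem_Icc.2 hts) (Set.right_mem_Icc.2 hts)
  rwa [Real.norm_eq_abs, Real.norm_eq_abs, abs_of_nonneg (sub_nonneg.2 hts)] at this

lemma stab_eq (R : RatFunc ℝ) (s : ℝ) : stab R s = R.num.eval s / R.denom.eval s := rfl

lemma StabilityAssumption.stab_pos {R : RatFunc ℝ} (hR : StabilityAssumption R) {s : ℝ}
    (hs : 0 ≤ s) : 0 < stab R s := by
  rcases hs.eq_or_lt with rfl | h
  · rw [hR.value_zero]; exact one_pos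
  · exact (hR.mem_Ioo s h).1

lemma exists_log_stab_sub_bound {R : RatFunc ℝ} (hR : StabilityAssumption R) :
    ∃ K : ℝ, 0 ≤ K ∧ ∀ s t : ℝ, 0 ≤ t → t ≤ s →
      |Real.log (stab R s) - Real.log (stab R t)| ≤ K / (1 + t) * (s - t) := by
  have hn : ∀ s : ℝ, 0 ≤ s → R.num.eval s ≠ 0 := fun s hs h => by
    have := hR.stab_pos hs
    rw [stab_eq, h, zero_div] at this
    exact this.false
  -- Division by zero yields 0, so positivity of `stab` also excludes poles.
  have hd : ∀ s : ℝ, 0 ≤ s → R.denom.eval s ≠ 0 := fun s hs h => by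
    have := hR.stab_pos hs
    rw [stab_eq, h, div_zero] at this
    exact this.false
  obtain ⟨K, hK, h1⟩ := exists_log_eval_sub_bound _ hn
  obtain ⟨L, hL, h2⟩ := exists_log_eval_sub_bound _ hd
  refine ⟨K + L, by positivity, fun s t ht hts => ?_⟩
  have hs := ht.trans hts
  rw [stab_eq, stab_eq, Real.log_div (hn s hs) (hd s hs), Real.log_div (hn t ht) (hd t ht)]
  calc _ = |(Real.log (R.num.eval s) - Real.log (R.num.eval t)) -
        (Real.log (R.denom.eval s) - Real.log (R.denom.eval t))| := by congr 1; ring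
    _ ≤ _ := abs_sub _ _
    _ ≤ _ := add_le_add (h1 s t ht hts) (h2 s t ht hts)
    _ = _ := by ring

lemma abs_exp_sub_one_le_mul_exp (y : ℝ) : |Real.exp y - 1| ≤ |y| * Real.exp |y| := by
  have h1 := Real.add_one_le_exp y
  have h2 := Real.add_one_le_exp (-y)
  have h3 : Real.exp y * Real.exp (-y) = 1 := by rw [← Real.exp_add]; simp
  have h4 := Real.exp_pos y
  have h5 : 1 ≤ Real.exp |y| := Real.one_le_exp (abs_nonneg y)
  have h6 : Real.exp y ≤ Real.exp |y| := Real.exp_le_exp.2 (le_abs_self y)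
  have h7 := abs_nonneg y
  rw [abs_le]
  constructor
  · nlinarith [neg_abs_le y]
  · have : Real.exp y - 1 ≤ y * Real.exp y := by nlinarith
    nlinarith [le_abs_self y]

/-- The cap `c` freezes the exponential factor, so that the bound stays linear in `δ`. -/
lemma abs_div_sub_one_le {a b c δ : ℝ} (ha : 0 < a) (hb : 0 < b)
    (h : |Real.log a - Real.log b| ≤ δ) (hδ : δ ≤ c) : |a / b - 1| ≤ δ * Real.exp c := by
  have e : a / b = Real.exp (Real.log a - Real.log b) := by
    rw [Real.exp_sub, Real.exp_log ha, Real.exp_log hb]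
  rw [e]
  refine (abs_exp_sub_one_le_mul_exp _).trans ?_
  exact mul_le_mul h (Real.exp_le_exp.2 (h.trans hδ)) (Real.exp_pos _).le
    ((abs_nonneg _).trans h)

lemma G₁_eq (T : CPType) (R : RatFunc ℝ) {J : ℕ} (hJ : 2 ≤ J) (z : ℝ) :
    G₁ T R J z = stab R (J * z) := by
  have : (J : ℝ) ≠ 0 := by positivity
  cases T <;> simp [G₁, stage, this]

/-- The two coarse propagators agree up to a relative error `O((s / (1 + s)) / J)`, `s = J z`. -/
lemma exists_ratio_bound (T : CPType) {R : RatFunc ℝ} (hR : StabilityAssumption R) :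
    ∃ C : ℝ, 0 ≤ C ∧ ∀ J : ℕ, 2 ≤ J → ∀ z : ℝ, 0 < z →
      |G₂ T R J z / G₁ T R J z - 1| ≤ C * (z / (1 + J * z)) ∧
      |G₁ T R J z / G₂ T R J z - 1| ≤ C * (z / (1 + J * z)) := by
  obtain ⟨K, hK, h⟩ := exists_log_stab_sub_bound hR
  refine ⟨2 * K * Real.exp (2 * K), by positivity, fun J hJ z hz => ?_⟩
  have hJ2 : (2 : ℝ) ≤ J := by exact_mod_cast hJ
  have hJz : 0 < (J : ℝ) * z := by positivity
  have hpos := hR.stab_pos hJz.le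
  rw [G₁_eq T R hJ]
  cases T with
  | I =>
    have : G₂ .I R J z = stab R (J * z) := rfl
    rw [this, div_self hpos.ne', sub_self, abs_zero]
    exact ⟨by positivity, by positivity⟩
  | II =>
    have e : G₂ .II R J z = stab R ((J - 1) * z) := by
      have : (J : ℝ) ≠ 0 := by positivity
      simp only [G₂, stage]
      congr 1
      push_cast
      field_simp
      ring
    have ht : 0 ≤ ((J : ℝ) - 1) * z := by nlinarith
    have hpos' := hR.stab_pos ht
    rw [e]
    have hl := h (J * z) ((J - 1) * z) ht (by nlinarith)
    have hb : K / (1 + (J - 1) * z) * (J * z - (J - 1) * z) ≤ 2 * K * (z / (1 + J * z)) := by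
      have e2 : (J : ℝ) * z - (J - 1) * z = z := by ring
      rw [e2, div_mul_eq_mul_div, ← mul_div_assoc,
        div_le_div_iff₀ (by positivity) (by positivity)]
      have : 0 ≤ K * z := by positivity
      have : 1 + J * z ≤ 2 * (1 + (J - 1) * z) := by nlinarith
      nlinarith
    have hc : 2 * K * (z / (1 + J * z)) ≤ 2 * K := by
      have : z / (1 + J * z) ≤ 1 := by
        rw [div_le_one (by positivity)]; nlinarith
      nlinarith
    have hl' := hl.trans hb
    constructor
    · rw [abs_sub_comm] at hl'
      refine (abs_div_sub_one_le hpos' hpos hl' hc).trans (le_of_eq (by ring))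
    · exact (abs_div_sub_one_le hpos hpos' hl' hc).trans (le_of_eq (by ring))

/-! ### Bounds for `F₁` and `F₂` -/

/-- The BDF2 solution, with the index shifted so that the starting values are the terms `0`, `1`. -/
noncomputable def bdf2Seq (z u v : ℝ) : ℕ → ℝ
  | 0 => u
  | n + 1 => bdf2 z u v n

lemma bdf2Seq_rec {z : ℝ} (hz : 0 < z) (u v : ℝ) (n : ℕ) :
    (3 + 2 * z) * bdf2Seq z u v (n + 2) = 4 * bdf2Seq z u v (n + 1) - bdf2Seq z u v n := by
  have : 3 + 2 * z ≠ 0 := by positivity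
  cases n <;> simp only [bdf2Seq, bdf2] <;> field_simp

lemma bdf2_add (z u v u' v' : ℝ) (n : ℕ) :
    bdf2 z (u + u') (v + v') n = bdf2 z u v n + bdf2 z u' v' n := by
  induction n using Nat.strong_induction_on with
  | _ n ih =>
    match n with
    | 0 => rfl
    | 1 => simp only [bdf2]; ring
    | n + 2 =>
      simp only [bdf2]
      rw [ih n (by omega), ih (n + 1) (by omega)]
      ring

lemma F₁_add_F₂ (n : ℕ) (z : ℝ) : F₁ n z + F₂ n z = bdf2 z 1 1 n := by
  rw [F₁, F₂, ← bdf2_add]; norm_num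

lemma abs_F₁_le {z : ℝ} (hz : 0 < z) (n : ℕ) : |F₁ n z| ≤ 33 := by
  refine (bdf2_decay hz (bdf2Seq_rec hz 1 0) (by simp [bdf2Seq]) (by simp [bdf2Seq, bdf2]) n).trans
    (div_le_self (by norm_num) ?_)
  have : 0 ≤ (n : ℝ) * z := by positivity
  linarith

lemma abs_F₂_le {z : ℝ} (hz : 0 < z) (n : ℕ) : |F₂ n z| ≤ 33 := by
  refine (bdf2_decay hz (bdf2Seq_rec hz 0 1) (by simp [bdf2Seq]) (by simp [bdf2Seq, bdf2]) n).trans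
    (div_le_self (by norm_num) ?_)
  have : 0 ≤ (n : ℝ) * z := by positivity
  linarith

lemma abs_F₁_sub_le {z : ℝ} (hz : 0 < z) {J : ℕ} (hJ : 1 ≤ J) :
    |F₁ (J - 1) z - F₁ J z| ≤ 132 / J := by
  obtain ⟨n, rfl⟩ := Nat.exists_eq_add_of_le' hJ
  have h := bdf2_diff hz (bdf2Seq_rec hz 1 0) (by simp [bdf2Seq]) (by simp [bdf2Seq, bdf2]) (n + 1)
  rw [abs_sub_comm]
  refine h.trans ?_
  gcongr
  linarith

/-- Equal starting values have zero initial difference; this gains the factor `z` that `F₁` alone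
lacks. -/
lemma abs_F_sum_sub_le {z : ℝ} (hz : 0 < z) {J : ℕ} (hJ : 1 ≤ J) :
    |(F₁ (J - 1) z + F₂ (J - 1) z) - (F₁ J z + F₂ J z)| ≤ 132 * (z / (1 + J * z)) := by
  obtain ⟨n, rfl⟩ := Nat.exists_eq_add_of_le' hJ
  have h := bdf2_diff_of_one hz (bdf2Seq_rec hz 1 1) rfl rfl (n + 1)
  rw [F₁_add_F₂, F₁_add_F₂, abs_sub_comm, ← mul_div_assoc]
  exact h

lemma abs_F_sum_sub_exp_le {z : ℝ} (hz : 0 < z) (J : ℕ) :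
    |F₁ J z + F₂ J z - Real.exp (-(J * z))| ≤ 336 * (z / (1 + J * z)) := by
  rw [F₁_add_F₂, ← mul_div_assoc]
  exact bdf2_error hz (bdf2Seq_rec hz 1 1) rfl rfl J

/-! ### From `γ_lin` to the coefficients of the cubic -/

/-- The plain convergence factor is positive, attained, and bounds the convergence function. -/
lemma plainConvFactor_spec {R : RatFunc ℝ} (hR : StabilityAssumption R) :
    0 < plainConvFactor R ∧ (∀ s, 0 < s → |plainConvFun R s| ≤ plainConvFactor R) ∧
      ∃ s₀, 0 < s₀ ∧ |plainConvFun R s₀| = plainConvFactor R := by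
  obtain ⟨s₀, h0, hne, hmax⟩ := hR.unique_max
  have hs₀ : 0 < s₀ := lt_of_le_of_ne h0 hne.symm
  have hle : ∀ s, 0 < s → |plainConvFun R s| ≤ |plainConvFun R s₀| := by
    intro s hs
    by_cases h : s = s₀
    · rw [h]
    · exact (hmax s hs.le h).le
  have hgr : IsGreatest ((fun s => |plainConvFun R s|) '' Set.Ioi 0) |plainConvFun R s₀| := by
    refine ⟨⟨s₀, hs₀, rfl⟩, ?_⟩
    rintro _ ⟨s, hs, rfl⟩
    exact hle s hs
  have e : plainConvFactor R = |plainConvFun R s₀| := hgr.csSup_eq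
  rw [e]
  -- Positivity comes from the strict comparison with `s = 0`.
  exact ⟨(abs_nonneg _).trans_lt (hmax 0 le_rfl hne.symm), hle, s₀, hs₀, rfl⟩

/-- The sizes of the coefficients `η₁, …, η₄` in terms of `J` and `1 - |G₁|`. -/
lemma exists_eta_bounds (T : CPType) {R : RatFunc ℝ} (hR : StabilityAssumption R) :
    ∃ a : ℝ, 1 ≤ a ∧ ∀ J : ℕ, 2 ≤ J → ∀ z : ℝ, 0 < z →
      (0 < G₁ T R J z ∧ G₁ T R J z < 1) ∧
      |η₁ T R J z| ≤ a / J ∧ |η₂ T R J z| ≤ a * (1 - G₁ T R J z) / J ∧ |η₃ T R J z| ≤ a ∧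
      |η₄ T R J z| ≤ a * (1 - G₁ T R J z) ∧
      |η₄ T R J z / (1 - G₁ T R J z) - plainConvFun R (J * z)| ≤ a / J ∧
      |plainConvFun R (J * z)| ≤ a := by
  obtain ⟨C, hC, hratio⟩ := exists_ratio_bound T hR
  obtain ⟨hg, hle, -⟩ := plainConvFactor_spec hR
  set g := plainConvFactor R
  have ha0 : 0 ≤ (336 + 99 * C) * g := by positivity
  obtain ⟨a, ha1, ha2⟩ : ∃ a : ℝ, 1 + g + (336 + 99 * C) ≤ a ∧
      g + (336 + 99 * C) * (1 + g) ≤ a :=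
    ⟨1 + g + (336 + 99 * C) * (1 + g), by linarith, by linarith⟩
  refine ⟨a, by linarith, fun J hJ z hz => ?_⟩
  have hJ2 : (2 : ℝ) ≤ J := by exact_mod_cast hJ
  have hJ0 : (0 : ℝ) < J := by linarith
  have hs : 0 < (J : ℝ) * z := by positivity
  obtain ⟨hρ, hσ⟩ := hratio J hJ z hz
  have hG := hR.mem_Ioo _ hs
  have hγ := hle _ hs
  have hG1 := G₁_eq T R hJ z
  rw [← hG1] at hG
  obtain ⟨hGpos, hGlt⟩ := hG
  have hγe : plainConvFun R (J * z) = (Real.exp (-(J * z)) - G₁ T R J z) / (1 - G₁ T R J z) := by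
    rw [plainConvFun, ← hG1, abs_of_pos hGpos]
  have hf1 := abs_F₁_le hz J
  have hf2 := abs_F₂_le hz (J - 1)
  have hd1 := abs_F₁_sub_le hz (by omega : 1 ≤ J)
  have hd2 := abs_F_sum_sub_le hz (by omega : 1 ≤ J)
  have herr := abs_F_sum_sub_exp_le hz J
  have hexp := exp_neg_le_one_div hs.le
  unfold η₁ η₂ η₃ η₄
  generalize hGg : G₁ T R J z = G at *
  generalize G₂ T R J z / G = ρ at *
  generalize G / G₂ T R J z = σ at *
  generalize hE : Real.exp (-(J * z)) = E at *
  generalize F₁ J z = f₁ at *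
  generalize F₂ J z = f₂ at *
  generalize F₁ (J - 1) z = f₁' at *
  generalize F₂ (J - 1) z = f₂' at *
  generalize hq : z / (1 + J * z) = q at *
  have hD : 0 < 1 - G := by linarith
  have hq0 : 0 ≤ q := by rw [← hq]; positivity
  have hqJ : q * J = 1 - 1 / (1 + J * z) := by rw [← hq]; field_simp; ring
  have hγD : |E - G| ≤ g * (1 - G) := by
    rw [hγe, abs_div, abs_of_pos hD, div_le_iff₀ hD] at hγ
    exact hγ
  -- Here `q J = 1 - 1/(1+s) ≤ 1 - E = (1 - G) - (E - G)`, and `|E - G| ≤ g (1 - G)`.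
  have hqD : q ≤ (1 + g) * (1 - G) / J := by
    rw [le_div_iff₀ hJ0]
    have := neg_abs_le (E - G)
    linarith
  have hq1 : q ≤ 1 / J := by
    rw [le_div_iff₀ hJ0, hqJ]
    have : 0 ≤ 1 / (1 + J * z) := by positivity
    linarith
  have hfρ : |f₁ * (ρ - 1)| ≤ 33 * (C * q) := by
    rw [abs_mul]
    exact mul_le_mul hf1 hρ (abs_nonneg _) (by norm_num)
  have hfσ : |f₂' * (σ - 1)| ≤ 33 * (C * q) := by
    rw [abs_mul]
    exact mul_le_mul hf2 hσ (abs_nonneg _) (by norm_num)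
  have hCq : C * q ≤ C * (1 / J) := by gcongr
  have h4 : |(f₁ * ρ + f₂ - G) - (E - G)| ≤ (336 + 99 * C) * (1 + g) * (1 - G) / J := by
    calc _ = |(f₁ + f₂ - E) + f₁ * (ρ - 1)| := by congr 1; ring
      _ ≤ 336 * q + 33 * (C * q) := (abs_add_le _ _).trans (add_le_add herr hfρ)
      _ ≤ (336 + 99 * C) * q := by nlinarith [mul_nonneg hC hq0]
      _ ≤ (336 + 99 * C) * ((1 + g) * (1 - G) / J) := by gcongr
      _ = _ := by ring
  refine ⟨⟨hGpos, hGlt⟩, ?_, ?_, ?_, ?_, ?_, ?_⟩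
  · calc _ = |(f₁' - f₁) - f₁ * (ρ - 1)| := by congr 1; ring
      _ ≤ 132 / J + 33 * (C * (1 / J)) :=
        (abs_sub _ _).trans (add_le_add hd1 (hfρ.trans (by linarith)))
      _ = (132 + 33 * C) / J := by ring
      _ ≤ _ := by gcongr; linarith
  · calc _ = |((f₁' + f₂') - (f₁ + f₂)) + f₂' * (σ - 1) - f₁ * (ρ - 1)| := by congr 1; ring
      _ ≤ (132 * q + 33 * (C * q)) + 33 * (C * q) :=
        (abs_sub _ _).trans (add_le_add ((abs_add_le _ _).trans (add_le_add hd2 hfσ)) hfρ)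
      _ ≤ (336 + 99 * C) * q := by nlinarith [mul_nonneg hC hq0]
      _ ≤ (336 + 99 * C) * ((1 + g) * (1 - G) / J) := by gcongr
      _ = (336 + 99 * C) * (1 + g) * (1 - G) / J := by ring
      _ ≤ _ := by gcongr; linarith
  · have h1J : 1 / (J : ℝ) ≤ 1 := by rw [div_le_one hJ0]; linarith
    calc _ = |f₁ + f₁ * (ρ - 1)| := by congr 1; ring
      _ ≤ 33 + 33 * (C * (1 / J)) :=
        (abs_add_le _ _).trans (add_le_add hf1 (hfρ.trans (by linarith)))
      _ ≤ 33 + 33 * (C * 1) := by gcongr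
      _ ≤ _ := by linarith
  · calc _ = |((f₁ * ρ + f₂ - G) - (E - G)) + (E - G)| := by congr 1; ring
      _ ≤ (336 + 99 * C) * (1 + g) * (1 - G) / J + g * (1 - G) :=
        (abs_add_le _ _).trans (add_le_add h4 hγD)
      _ ≤ (336 + 99 * C) * (1 + g) * (1 - G) + g * (1 - G) := by
        gcongr
        exact div_le_self (by positivity) (by linarith)
      _ = (g + (336 + 99 * C) * (1 + g)) * (1 - G) := by ring
      _ ≤ _ := by gcongr
  · rw [hγe, ← sub_div, abs_div, abs_of_pos hD, div_le_iff₀ hD]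
    refine h4.trans ?_
    rw [div_mul_eq_mul_div]
    gcongr
    linarith
  · linarith

/-- The series defining `γa` differs from `η₄² / (1 - G)²` by at most `|η₂ η₃| / (1 - G)`. -/
lemma abs_tsum_sub_le {G h p : ℝ} (hG : 0 ≤ G) (hG1 : G < 1) :
    |(∑' m : ℕ, G ^ m * |((m : ℝ) + 1) * h ^ 2 + p|) - h ^ 2 / (1 - G) ^ 2| ≤ |p| / (1 - G) := by
  have hD : 0 < 1 - G := by linarith
  have hn : ‖G‖ < 1 := by rwa [Real.norm_eq_abs, abs_of_nonneg hG]
  have s1 : HasSum (fun m : ℕ => G ^ m) (1 - G)⁻¹ := hasSum_geometric_of_lt_one hG hG1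
  have s2 : HasSum (fun m : ℕ => G ^ m * (((m : ℝ) + 1) * h ^ 2)) (h ^ 2 / (1 - G) ^ 2) := by
    have s3 := ((hasSum_coe_mul_geometric_of_norm_lt_one hn).add s1).mul_left (h ^ 2)
    have e1 : h ^ 2 * (G / (1 - G) ^ 2 + (1 - G)⁻¹) = h ^ 2 / (1 - G) ^ 2 := by
      field_simp
      ring
    have e2 : (fun m : ℕ => h ^ 2 * (m * G ^ m + G ^ m)) =
        fun m : ℕ => G ^ m * (((m : ℝ) + 1) * h ^ 2) := by
      funext m; ring
    rwa [e1, e2] at s3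
  have s4 : HasSum (fun m : ℕ => G ^ m * |p|) (|p| / (1 - G)) := by
    rw [div_eq_inv_mul]
    exact s1.mul_right |p|
  have hb : ∀ m : ℕ, |G ^ m * |((m : ℝ) + 1) * h ^ 2 + p| - G ^ m * (((m : ℝ) + 1) * h ^ 2)| ≤
      G ^ m * |p| := by
    intro m
    have h0 : 0 ≤ ((m : ℝ) + 1) * h ^ 2 := by positivity
    rw [← mul_sub, abs_mul, abs_of_nonneg (pow_nonneg hG m)]
    refine mul_le_mul_of_nonneg_left ?_ (pow_nonneg hG m)
    have := abs_abs_sub_abs_le (((m : ℝ) + 1) * h ^ 2 + p) (((m : ℝ) + 1) * h ^ 2)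
    rwa [abs_of_nonneg h0, add_sub_cancel_left] at this
  have s5 : Summable (fun m : ℕ =>
      G ^ m * |((m : ℝ) + 1) * h ^ 2 + p| - G ^ m * (((m : ℝ) + 1) * h ^ 2)) :=
    Summable.of_norm_bounded s4.summable hb
  have s6 := s5.hasSum.add s2
  simp only [sub_add_cancel] at s6
  rw [s6.tsum_eq, add_sub_cancel_right]
  exact tsum_of_norm_bounded (E := ℝ) s4 hb

/-- `γa` is close to the square of the plain convergence function, and the other coefficients of
the cubic are small. -/
lemma exists_gamma_bounds (T : CPType) {R : RatFunc ℝ} (hR : StabilityAssumption R) :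
    ∃ κ : ℝ, 0 ≤ κ ∧ ∀ J : ℕ, 2 ≤ J → ∀ z : ℝ, 0 < z →
      |γa T R J z - plainConvFun R (J * z) ^ 2| ≤ κ / J ∧
      γb T R J z ∈ Set.Icc 0 (κ / J) ∧ γe T R J z ∈ Set.Icc 0 (κ / J) ∧
      γc T R J z * γd T R J z ∈ Set.Icc 0 (κ / J) := by
  obtain ⟨a, ha, H⟩ := exists_eta_bounds T hR
  -- `12 a⁶ = 4 a⁴ * 3 a²` comes from `γc γd`; as `a ≥ 1`, it dominates the other constants.
  refine ⟨12 * a ^ 6, by positivity, fun J hJ z hz => ?_⟩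
  obtain ⟨⟨hG, hG1⟩, h1, h2, h3, h4, h4γ, hγ⟩ := H J hJ z hz
  have hJ1 : (1 : ℝ) ≤ J := by exact_mod_cast (by omega : 1 ≤ J)
  have hJ0 : (0 : ℝ) < J := by linarith
  unfold γa γb γc γd γe
  rw [abs_of_pos hG]
  generalize G₁ T R J z = G at *
  generalize η₁ T R J z = e₁ at *
  generalize η₂ T R J z = e₂ at *
  generalize η₃ T R J z = e₃ at *
  generalize η₄ T R J z = e₄ at *
  generalize plainConvFun R (J * z) = γ at *
  simp only [abs_mul, abs_pow]
  rw [abs_of_pos hG]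
  have hD : 0 < 1 - G := by linarith
  set D := 1 - G with hDdef
  have hD1 : D ≤ 1 := by linarith
  have ha2 : a ^ 2 ≤ a ^ 6 := pow_le_pow_right₀ ha (by norm_num)
  have ha4 : a ^ 4 ≤ a ^ 6 := pow_le_pow_right₀ ha (by norm_num)
  have ha0 : 0 < a := by linarith
  have haJ : a / J ≤ a := div_le_self ha0.le hJ1
  have h1' : |e₁| ≤ a := h1.trans haJ
  have h23 : |e₂| * |e₃| / D ≤ a ^ 2 / J := by
    rw [div_le_iff₀ hD]
    calc |e₂| * |e₃| ≤ (a * D / J) * a := by gcongr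
      _ = _ := by ring
  have h4D : |e₄| / D ≤ a := by rwa [div_le_iff₀ hD]
  have h4D' : |e₄ / D| ≤ a := by rwa [abs_div, abs_of_pos hD]
  refine ⟨?_, ⟨by positivity, ?_⟩, ⟨by positivity, ?_⟩, ⟨by positivity, ?_⟩⟩
  · have t1 := abs_tsum_sub_le (h := e₄) (p := e₂ * e₃) hG.le hG1
    rw [abs_mul, ← hDdef] at t1
    have t2 : |e₄ ^ 2 / D ^ 2 - γ ^ 2| ≤ 2 * a ^ 2 / J := by
      calc _ = |e₄ / D - γ| * |e₄ / D + γ| := by rw [← div_pow, sq_sub_sq, abs_mul, mul_comm]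
        _ ≤ a / J * (a + a) := by
          gcongr
          exact (abs_add_le _ _).trans (add_le_add h4D' hγ)
        _ = _ := by ring
    calc _ ≤ a ^ 2 / J + 2 * a ^ 2 / J :=
          (abs_sub_le _ (e₄ ^ 2 / D ^ 2) _).trans (add_le_add (t1.trans h23) t2)
      _ = 3 * a ^ 2 / J := by ring
      _ ≤ _ := by gcongr; norm_num
  · calc _ ≤ a ^ 2 / J * (a + a) ^ 2 := by gcongr
      _ = 4 * a ^ 4 / J := by ring
      _ ≤ _ := by gcongr; norm_num
  · have t1 : G * |e₂| * |e₃| / D ≤ a ^ 2 / J := by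
      calc _ = G * (|e₂| * |e₃| / D) := by ring
        _ ≤ 1 * (a ^ 2 / J) := by gcongr
        _ = _ := one_mul _
    have t2 : |e₂ * e₃ + e₁ ^ 2| ≤ a ^ 2 / J + a ^ 2 / J := by
      refine (abs_add_le _ _).trans (add_le_add ?_ ?_)
      · rw [abs_mul]
        exact (le_div_self (by positivity) hD hD1).trans h23
      · rw [abs_pow]
        calc |e₁| ^ 2 = |e₁| * |e₁| := sq _
          _ ≤ a * (a / J) := by gcongr
          _ = _ := by ring
    calc _ ≤ a ^ 2 / J + (a ^ 2 / J + a ^ 2 / J) := add_le_add t1 t2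
      _ = 3 * a ^ 2 / J := by ring
      _ ≤ _ := by gcongr; norm_num
  -- `γc` is controlled only up to `1 / D`; the factor `D / J` in the bound for `γd` compensates.
  · have c1 : |e₂| * |e₃| ^ 2 * |e₄| / D ^ 3 ≤ a ^ 4 / D := by
      calc _ ≤ (a * D / J) * a ^ 2 * (a * D) / D ^ 3 := by gcongr
        _ = a ^ 4 / D / J := by field_simp
        _ ≤ _ := div_le_self (by positivity) hJ1
    have c2 : |e₁| * |e₂| * |e₃| ^ 2 / D ^ 2 ≤ a ^ 4 / D := by
      calc _ ≤ a * (a * D / J) * a ^ 2 / D ^ 2 := by gcongr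
        _ = a ^ 4 / D / J := by field_simp
        _ ≤ _ := div_le_self (by positivity) hJ1
    have c3 : |e₁| ^ 2 * |e₃| * |e₄| / D ^ 2 ≤ a ^ 4 / D := by
      calc _ ≤ a ^ 2 * a * (a * D) / D ^ 2 := by gcongr
        _ = a ^ 4 / D := by field_simp
    have c4 : |e₁| ^ 3 * |e₃| / D ≤ a ^ 4 / D := by
      calc _ ≤ a ^ 3 * a / D := by gcongr
        _ = a ^ 4 / D := by ring
    have d1 : G * |e₂| * |e₄| / D ≤ a ^ 2 * D / J := by
      calc _ ≤ 1 * (a * D / J) * (a * D) / D := by gcongr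
        _ = _ := by field_simp
    have d2 : |e₂| * |e₄ + e₁| ≤ 2 * a ^ 2 * D / J := by
      calc _ ≤ (a * D / J) * (a * 1 + a) := by
            gcongr
            exact (abs_add_le _ _).trans (add_le_add (h4.trans (by gcongr)) h1')
        _ = _ := by ring
    calc _ ≤ (a ^ 4 / D + a ^ 4 / D + a ^ 4 / D + a ^ 4 / D) *
          (a ^ 2 * D / J + 2 * a ^ 2 * D / J) := by gcongr
      _ = _ := by field_simp; ring

/-! ### Location of the roots -/

/-- An upper bound for the roots of the cubic `(ξ - A) ξ (ξ - E) = B (ξ - E) + P`. -/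
lemma cubic_root_norm_le {A B E P g t : ℝ} (hg : 0 < g) (hA0 : 0 ≤ A) (hA : A ≤ g + t)
    (hB : B ∈ Set.Icc 0 t) (hE : E ∈ Set.Icc 0 t) (hP : P ∈ Set.Icc 0 t) {ξ : ℂ}
    (h : ξ ^ 3 - ((A + E : ℝ) : ℂ) * ξ ^ 2 + ((A * E - B : ℝ) : ℂ) * ξ +
      ((B * E - P : ℝ) : ℂ) = 0) :
    ‖ξ‖ ≤ g + (1 + (1 + 1 / g) / g) * t := by
  by_contra! hc
  have ht : 0 ≤ t := hB.1.trans hB.2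
  have hk : 0 ≤ (1 + 1 / g) / g * t := by positivity
  have heq : (ξ - A) * ξ * (ξ - E) = B * (ξ - E) + P := by
    push_cast at h
    linear_combination h
  -- One `t` of the assumed excess covers `A ≤ g + t`; multiplying the rest by `‖ξ‖ ≥ g` gives `t (1
  -- + 1/g)`, which bounds the right side divided by `‖ξ - E‖`.
  have n1 : (1 + 1 / g) / g * t < ‖ξ - A‖ := by
    have := norm_sub_norm_le ξ (A : ℂ)
    rw [Complex.norm_real, Real.norm_eq_abs, abs_of_nonneg hA0] at this
    linarith
  have n2 : g ≤ ‖ξ - E‖ := by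
    have := norm_sub_norm_le ξ (E : ℂ)
    rw [Complex.norm_real, Real.norm_eq_abs, abs_of_nonneg hE.1] at this
    linarith [hE.2]
  have n3 : g ≤ ‖ξ‖ := by linarith
  have hN : 0 < ‖ξ - E‖ := hg.trans_le n2
  have h1 : ‖ξ - A‖ * ‖ξ‖ * ‖ξ - E‖ ≤ (t * (1 + 1 / g)) * ‖ξ - E‖ := by
    calc _ = ‖(B : ℂ) * (ξ - E) + P‖ := by rw [← heq, norm_mul, norm_mul]
      _ ≤ ‖(B : ℂ) * (ξ - E)‖ + ‖(P : ℂ)‖ := norm_add_le _ _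
      _ = B * ‖ξ - E‖ + P := by
        rw [norm_mul, Complex.norm_real, Complex.norm_real, Real.norm_eq_abs, Real.norm_eq_abs,
          abs_of_nonneg hB.1, abs_of_nonneg hP.1]
      _ ≤ t * ‖ξ - E‖ + t * (‖ξ - E‖ / g) := by
        have : 1 ≤ ‖ξ - E‖ / g := by rwa [one_le_div hg]
        have : t * 1 ≤ t * (‖ξ - E‖ / g) := by gcongr
        have : B * ‖ξ - E‖ ≤ t * ‖ξ - E‖ := by gcongr; exact hB.2
        linarith [hP.2]
      _ = _ := by ring
  have h2 := le_of_mul_le_mul_right h1 hN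
  have h3 : (1 + 1 / g) / g * t * g < ‖ξ - A‖ * ‖ξ‖ :=
    mul_lt_mul n1 n3 hg (norm_nonneg _)
  have h4 : (1 + 1 / g) / g * t * g = t * (1 + 1 / g) := by field_simp
  linarith

/-- The cubic has a real root that is at least `A`. -/
lemma exists_cubic_root_ge {A B E P : ℝ} (hB : 0 ≤ B) (hP : 0 ≤ P) :
    ∃ y : ℝ, A ≤ y ∧ y ^ 3 - (A + E) * y ^ 2 + (A * E - B) * y + (B * E - P) = 0 := by
  set f : ℝ → ℝ := fun y => (y - A) * y * (y - E) - B * (y - E) - P with hf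
  have hcont : Continuous f := by fun_prop
  -- At `A` and at `E` the cubic product vanishes, leaving only nonpositive terms at the larger one.
  have h1 : f (max A E) ≤ 0 := by
    rcases le_total A E with h | h
    · simp only [hf, max_eq_right h]; simp; linarith
    · simp only [hf, max_eq_left h]
      have : 0 ≤ B * (A - E) := mul_nonneg hB (by linarith)
      simp; linarith
  obtain ⟨y₁, hy₁, h2⟩ : ∃ y₁, max A E ≤ y₁ ∧ 0 ≤ f y₁ := by
    set M := |A| + |E| + 1 + B + P with hM
    have a1 := le_abs_self A
    have a2 := le_abs_self E
    have a3 := abs_nonneg A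
    have a4 := abs_nonneg E
    have b1 : 1 + B + P ≤ M - A := by linarith
    have b2 : 1 ≤ M := by linarith
    have b3 : 1 ≤ M - E := by linarith
    refine ⟨M, max_le (by linarith) (by linarith), ?_⟩
    have c1 : 1 + B + P ≤ (M - A) * M := by nlinarith
    have c2 : (1 + B + P) * (M - E) ≤ (M - A) * M * (M - E) := by gcongr
    simp only [hf]
    nlinarith
  obtain ⟨y, hy, hy0⟩ := intermediate_value_Icc hy₁ hcont.continuousOn ⟨h1, h2⟩
  refine ⟨y, (le_max_left _ _).trans hy.1, ?_⟩
  rw [← hy0]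
  simp only [hf]
  ring

end MultistepParareal

/-! ### Convergence of the multistep factor -/

open MultistepParareal in
theorem theorem5p2 (T : CPType) (R : RatFunc ℝ) (hR : StabilityAssumption R) :
    (∃ C : ℝ, ∀ J : ℕ, 2 ≤ J →
      BddAbove (multistepConvFun T R J '' Set.Ioi 0) ∧
      |multistepConvFactor T R J - plainConvFactor R ^ 2| ≤ C / (J : ℝ)) ∧
    Filter.Tendsto (fun J : ℕ => multistepConvFactor T R J) Filter.atTop
      (nhds (plainConvFactor R ^ 2)) := by
  obtain ⟨hg, hle, s₀, hs₀, hmax⟩ := plainConvFactor_spec hR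
  obtain ⟨κ, hκ, H⟩ := exists_gamma_bounds T hR
  set g := plainConvFactor R
  have hg2 : 0 < g ^ 2 := by positivity
  set K := 1 + (1 + 1 / g ^ 2) / g ^ 2 with hK
  have hK1 : 1 ≤ K := by
    have : 0 ≤ (1 + 1 / g ^ 2) / g ^ 2 := by positivity
    linarith
  have hγa : ∀ J z, 0 ≤ γa T R J z := fun J z => tsum_nonneg fun m => by positivity
  have hroot : ∀ J : ℕ, 2 ≤ J → ∀ z : ℝ, 0 < z →
      ∀ ξ ∈ cubicRoots T R J z, ‖ξ‖ ≤ g ^ 2 + K * (κ / J) := by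
    intro J hJ z hz ξ hξ
    obtain ⟨ha, hb, he, hp⟩ := H J hJ z hz
    refine cubic_root_norm_le hg2 (hγa J z) ?_ hb he hp hξ
    have h1 := (abs_le.1 ha).2
    have h2 : plainConvFun R (J * z) ^ 2 ≤ g ^ 2 := by
      rw [← sq_abs]
      exact pow_le_pow_left₀ (abs_nonneg _) (hle _ (by positivity)) 2
    linarith
  have hge : ∀ J : ℕ, 2 ≤ J → ∀ z : ℝ, 0 < z → ∃ ξ ∈ cubicRoots T R J z, γa T R J z ≤ ‖ξ‖ := by
    intro J hJ z hz
    obtain ⟨ha, hb, he, hp⟩ := H J hJ z hz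
    obtain ⟨y, hy, hy0⟩ := exists_cubic_root_ge (A := γa T R J z) (E := γe T R J z) hb.1 hp.1
    refine ⟨(y : ℂ), ?_, ?_⟩
    · change (y : ℂ) ^ 3 - _ * (y : ℂ) ^ 2 + _ * (y : ℂ) + _ = 0
      exact_mod_cast hy0
    · rw [Complex.norm_real]
      exact hy.trans (le_abs_self y)
  have hfun_le : ∀ J : ℕ, 2 ≤ J → ∀ z : ℝ, 0 < z →
      multistepConvFun T R J z ≤ g ^ 2 + K * (κ / J) := by
    intro J hJ z hz
    obtain ⟨ξ, hξ, -⟩ := hge J hJ z hz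
    refine csSup_le ⟨_, ξ, hξ, rfl⟩ ?_
    rintro _ ⟨ξ, hξ, rfl⟩
    exact hroot J hJ z hz ξ hξ
  have hbdd : ∀ J : ℕ, 2 ≤ J → BddAbove (multistepConvFun T R J '' Set.Ioi 0) := by
    intro J hJ
    refine ⟨g ^ 2 + K * (κ / J), ?_⟩
    rintro _ ⟨z, hz, rfl⟩
    exact hfun_le J hJ z hz
  have hmain : ∀ J : ℕ, 2 ≤ J → |multistepConvFactor T R J - g ^ 2| ≤ K * κ / J := by
    intro J hJ
    have hJ0 : (0 : ℝ) < J := by positivity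
    rw [abs_le, mul_div_assoc]
    constructor
    -- At `z = s₀ / J` the plain convergence function is evaluated at its maximizer.
    · have hz : 0 < s₀ / J := by positivity
      obtain ⟨ξ, hξ, h1⟩ := hge J hJ _ hz
      have h2 : ‖ξ‖ ≤ multistepConvFun T R J (s₀ / J) := by
        refine le_csSup ⟨g ^ 2 + K * (κ / J), ?_⟩ ⟨ξ, hξ, rfl⟩
        rintro _ ⟨ξ, hξ, rfl⟩
        exact hroot J hJ _ hz ξ hξ
      have h3 : multistepConvFun T R J (s₀ / J) ≤ multistepConvFactor T R J :=
        le_csSup (hbdd J hJ) ⟨_, hz, rfl⟩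
      have h4 := (abs_le.1 (H J hJ _ hz).1).1
      rw [mul_div_cancel₀ _ hJ0.ne', ← sq_abs, hmax] at h4
      have h5 : κ / J ≤ K * (κ / J) := le_mul_of_one_le_left (by positivity) hK1
      linarith
    · have : multistepConvFactor T R J ≤ g ^ 2 + K * (κ / J) := by
        refine csSup_le ⟨_, 1, Set.mem_Ioi.2 one_pos, rfl⟩ ?_
        rintro _ ⟨z, hz, rfl⟩
        exact hfun_le J hJ z hz
      linarith
  refine ⟨⟨K * κ, fun J hJ => ⟨hbdd J hJ, hmain J hJ⟩⟩, ?_⟩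
  rw [tendsto_iff_dist_tendsto_zero]
  refine squeeze_zero' (Filter.Eventually.of_forall fun _ => dist_nonneg) ?_
    (tendsto_const_div_atTop_nhds_zero_nat (K * κ))
  filter_upwards [Filter.eventually_ge_atTop 2] with J hJ
  exact hmain J hJ
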